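/- Let $\mathcal{N}$ be the category whose objects are finite sets and whose morphisms $X \to Y$ are maps $f : X \to Y$ together with a linear ordering on each fibre $f^{-1}(y)$; in the composite $g \circ f$ the fibre $(g\circ f)^{-1}(z)$ is ordered by $x \le x'$ if $f(x) < f(x')$ in $g^{-1}(z)$, or if $f(x) = f(x')$ and $x \le x'$ in $f^{-1}(f(x))$. Let $k$ be a field of characteristic zero and let $V$ be a functor from $\mathcal{N}$ to $k$-vector spaces that is finitely generated, i.e. there is a finite list of vectors $v_i \in V(c_i)$ such that no proper subfunctor (family of subspaces stable under all morphisms of $\mathcal N$) of $V$ contains all the $v_i$. For $n \ge 0$ let $[n]$ be the set $\{1,\dots,n\}$, and let $S_n$ act on $V[n]$ through its elements regarded as automorphisms of $[n]$ in $\mathcal{N}$. Then $V(X)$ is finite-dimensional for every finite set $X$, and there is a polynomial $P \in \mathbb{Q}[X_1, X_2, \dots]$ such that for all $n > 0$ and all $\sigma \in S_n$ $$\operatorname{tr}(\sigma \mid V[n]) = P\big(X_1(\sigma), X_2(\sigma), \dots\big),$$ where $X_j(\sigma)$ is the number of $j$-cycles in the cycle decomposition of $\sigma$ (so $X_1(\sigma)$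 is the number of fixed points). -/

import Mathlib

open CategoryTheory

universe u v w

/-- The objects of the category `𝒩` of noncommutative finite sets: finite sets. -/
structure NCFinSet : Type 1 where
  carrier : Type
  [finite : Finite carrier]

namespace NCFinSet

/-- A morphism of `𝒩` from `X` to `Y`: a map of sets together with a linear ordering on each
fibre. The orderings of all the fibres are recorded by one relation `le` on the source, which
relates only elements of the same fibre (`map_eq_of_le`) and whose restriction to each fibre
is a linear order (the other four fields). -/
@[ext]
structure Hom (X Y : Type) where
  toFun : X → Y
  le : X → X → Prop
  map_eq_of_le : ∀ {x x'}, le x x' → toFun x = toFun x'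
  le_refl : ∀ x, le x x
  le_trans : ∀ {x x' x''}, le x x' → le x' x'' → le x x''
  le_antisymm : ∀ {x x'}, le x x' → le x' x → x = x'
  le_total : ∀ {x x'}, toFun x = toFun x' → le x x' ∨ le x' x

/-- The map underlying a bijection, each fibre (a single point) carrying its unique order. -/
def Hom.ofEquiv {X Y : Type} (e : X ≃ Y) : Hom X Y where
  toFun := e
  le x x' := x = x'
  map_eq_of_le h := congrArg e h
  le_refl _ := rfl
  le_trans h h' := h.trans h'
  le_antisymm h _ := h
  le_total h := Or.inl (e.injective h)

/-- The composite "`f` then `g`". In a fibre of `g ∘ f`, one has `x ≤ x'` if `f x < f x'` in the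
ordered fibre of `g`, or if `f x = f x'` and `x ≤ x'` in the ordered fibre of `f`. -/
def Hom.comp {X Y Z : Type} (f : Hom X Y) (g : Hom Y Z) : Hom X Z where
  toFun x := g.toFun (f.toFun x)
  le x x' := (g.le (f.toFun x) (f.toFun x') ∧ f.toFun x ≠ f.toFun x') ∨
    (f.toFun x = f.toFun x' ∧ f.le x x')
  map_eq_of_le h := by
    rcases h with ⟨h, -⟩ | ⟨h, -⟩
    · exact g.map_eq_of_le h
    · exact congrArg g.toFun h
  le_refl x := Or.inr ⟨rfl, f.le_refl x⟩
  le_trans {x x' x''} h h' := by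
    rcases h with ⟨h, hn⟩ | ⟨h, hl⟩ <;> rcases h' with ⟨h', hn'⟩ | ⟨h', hl'⟩
    · exact Or.inl ⟨g.le_trans h h', fun e => hn (g.le_antisymm h (e ▸ h'))⟩
    · exact Or.inl ⟨h' ▸ h, h' ▸ hn⟩
    · exact Or.inl ⟨h ▸ h', h ▸ hn'⟩
    · exact Or.inr ⟨h.trans h', f.le_trans hl hl'⟩
  le_antisymm {x x'} h h' := by
    rcases h with ⟨h, hn⟩ | ⟨h, hl⟩ <;> rcases h' with ⟨h', hn'⟩ | ⟨h', hl'⟩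
    · exact absurd (g.le_antisymm h h') hn
    · exact absurd h'.symm hn
    · exact absurd h.symm hn'
    · exact f.le_antisymm hl hl'
  le_total {x x'} h := by
    by_cases e : f.toFun x = f.toFun x'
    · rcases f.le_total e with h' | h'
      · exact Or.inl (Or.inr ⟨e, h'⟩)
      · exact Or.inr (Or.inr ⟨e.symm, h'⟩)
    · rcases g.le_total h with h' | h'
      · exact Or.inl (Or.inl ⟨h', e⟩)
      · exact Or.inr (Or.inl ⟨h', fun e' => e e'.symm⟩)

theorem Hom.comp_assoc {W X Y Z : Type} (f : Hom W X) (g : Hom X Y) (h : Hom Y Z) :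
    (f.comp g).comp h = f.comp (g.comp h) := by
  refine Hom.ext rfl ?_
  funext x x'
  apply propext
  simp only [Hom.comp]
  by_cases e : f.toFun x = f.toFun x' <;>
    by_cases e' : g.toFun (f.toFun x) = g.toFun (f.toFun x') <;> simp_all

theorem Hom.id_comp {X Y : Type} (f : Hom X Y) : (Hom.ofEquiv (Equiv.refl X)).comp f = f := by
  refine Hom.ext rfl ?_
  funext x x'
  apply propext
  simp only [Hom.comp, Hom.ofEquiv, Equiv.refl_apply]
  by_cases e : x = x'
  · simp [e, f.le_refl]
  · simp [e]

theorem Hom.comp_id {X Y : Type} (f : Hom X Y) : f.comp (Hom.ofEquiv (Equiv.refl Y)) = f := by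
  refine Hom.ext rfl ?_
  funext x x'
  apply propext
  simp only [Hom.comp, Hom.ofEquiv, Equiv.refl_apply]
  constructor
  · rintro (⟨h, hn⟩ | ⟨-, h⟩)
    · exact absurd h hn
    · exact h
  · exact fun h => Or.inr ⟨f.map_eq_of_le h, h⟩

theorem Hom.ofEquiv_comp {X Y Z : Type} (e : X ≃ Y) (e' : Y ≃ Z) :
    (Hom.ofEquiv e).comp (Hom.ofEquiv e') = Hom.ofEquiv (e.trans e') := by
  refine Hom.ext rfl ?_
  funext x x'
  apply propext
  simp only [Hom.comp, Hom.ofEquiv]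
  constructor
  · rintro (⟨h, hn⟩ | ⟨-, h⟩)
    · exact absurd h hn
    · exact h
  · exact fun h => Or.inr ⟨congrArg e h, h⟩

/-- The category `𝒩` of noncommutative finite sets. -/
instance : Category.{0} NCFinSet where
  Hom X Y := Hom X.carrier Y.carrier
  id X := Hom.ofEquiv (Equiv.refl X.carrier)
  comp f g := Hom.comp f g
  id_comp f := Hom.id_comp f
  comp_id f := Hom.comp_id f
  assoc f g h := Hom.comp_assoc f g h

/-- The object `[n]` of `𝒩`, the standard set with `n` elements. -/
def std (n : ℕ) : NCFinSet where
  carrier := Fin n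

/-- A permutation, regarded as an endomorphism in `𝒩`. -/
def permHom {n : ℕ} (σ : Equiv.Perm (Fin n)) : std n ⟶ std n :=
  Hom.ofEquiv (X := Fin n) (Y := Fin n) σ

theorem permHom_one (n : ℕ) : permHom (1 : Equiv.Perm (Fin n)) = 𝟙 (std n) := rfl

theorem permHom_mul {n : ℕ} (σ τ : Equiv.Perm (Fin n)) :
    permHom (σ * τ) = permHom τ ≫ permHom σ :=
  (Hom.ofEquiv_comp (X := Fin n) (Y := Fin n) (Z := Fin n) τ σ).symm

end NCFinSet

/-- A subrepresentation of a functor `V` from a category `C` to `k`-vector spaces: a subspace of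
each `V.obj c`, stable under all morphisms of `C`. -/
structure FunctorSubrep {C : Type u} [Category.{v} C] {k : Type*} [Field k]
    (V : C ⥤ ModuleCat.{w} k) where
  space : ∀ c : C, Submodule k (V.obj c)
  map_mem : ∀ {c d : C} (f : c ⟶ d) (x : V.obj c), x ∈ space c → (V.map f).hom x ∈ space d

/-- `V` is finitely generated: there is a finite list of vectors `vᵢ ∈ V cᵢ` such that no proper
subrepresentation of `V` contains all of them. -/
def FunctorFinitelyGenerated {C : Type u} [Category.{v} C] {k : Type*} [Field k]
    (V : C ⥤ ModuleCat.{w} k) : Prop :=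
  ∃ (m : ℕ) (c : Fin m → C) (x : ∀ i, V.obj (c i)),
    ∀ W : FunctorSubrep V, (∀ i, x i ∈ W.space (c i)) → ∀ d : C, W.space d = ⊤

/-- The representation of the symmetric group `Sₙ` on `V [n]`, for an `𝒩`-representation `V`. -/
def symmRep {k : Type*} [Field k] (V : NCFinSet ⥤ ModuleCat.{w} k) (n : ℕ) :
    Representation k (Equiv.Perm (Fin n)) (V.obj (NCFinSet.std n)) where
  toFun σ := (V.map (NCFinSet.permHom σ)).hom
  map_one' := by
    rw [NCFinSet.permHom_one, V.map_id]
    rfl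
  map_mul' σ τ := by
    rw [NCFinSet.permHom_mul, V.map_comp]
    rfl

/-- The number `X_j(σ)` of `j`-cycles in the cycle decomposition of `σ`; fixed points are the
`1`-cycles (`Equiv.Perm.partition` counts them, unlike `Equiv.Perm.cycleType`). -/
def cycleCount {n : ℕ} (σ : Equiv.Perm (Fin n)) (j : ℕ+) : ℕ :=
  σ.partition.parts.count (j : ℕ)

/-- The value at `σ` of a character polynomial `P` in the variables `X₁, X₂, …`. -/
noncomputable def charPolyValue {n : ℕ} (P : MvPolynomial ℕ+ ℚ) (σ : Equiv.Perm (Fin n)) : ℚ :=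
  MvPolynomial.eval (fun j => (cycleCount σ j : ℚ)) P

/-! Suppose `V` is generated by its values on sets with at most `d` elements. Let `Z ⊆ Y` have more
than `d` points, let `b` be a point, and for `T ⊆ Z` let `collapse T b` move `T` to `b`. A map into
`Y` from a set with at most `d` elements misses some `z ∈ Z`, and its composite with the collapse
does not see whether `z ∈ T`. Hence the sum of `(-1)^|T| V(collapse T b)` over `T ⊆ Z` is zero
(`alternating_sum_collapse`).

Compose with a permutation `ρ` and take traces. The trace of `V(φ)` sees only the permutation that
`φ` induces on its eventual image (`trace_lmap_eq_permTrace`). If the cycle of `b` misses `T`,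
collapsing and then applying `ρ` leaves `ρ` with the cycles that meet `T` deleted.

So the trace, as a function of the multiset of cycle lengths, satisfies two relations. With `Z` one
point from each of more than `d` cycles, its finite differences of order above `d` vanish. With `Z`
a whole cycle of length above `d`, that cycle can be deleted without changing the trace. By Newton's
difference formula such a function is a polynomial in the multiplicities, with rational coefficients
because characters of symmetric groups are rational. A nonempty part must be kept to contain `b`;
this is why `n > 0`, and why polynomials for different kept parts have to be matched. -/

/-! ### Linear algebra: the trace of an endomorphism and of its invertible part. -/

section LinearAlgebra

variable {k : Type*} [Field k] {E F : Type*} [AddCommGroup E] [Module k E]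
  [AddCommGroup F] [Module k F]

/-- If `a` restricts along an injection `ι` to an invertible map `r`, and some power of `a` factors
through `ι`, then `a` and `r` have the same trace. -/
theorem LinearMap.trace_eq_of_pow_factors [FiniteDimensional k E] [FiniteDimensional k F]
    (a : E →ₗ[k] E) (r s : F →ₗ[k] F) (ι : F →ₗ[k] E) (q : E →ₗ[k] F) (N : ℕ)
    (hι : Function.Injective ι) (haι : a ∘ₗ ι = ι ∘ₗ r) (hrs : r * s = 1) (hsr : s * r = 1)
    (hq : ι ∘ₗ q = a ^ N) : LinearMap.trace k E a = LinearMap.trace k F r := by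
  have haι' : ∀ x, a (ι x) = ι (r x) := fun x => LinearMap.congr_fun haι x
  have hq' : ∀ x, ι (q x) = (a ^ N) x := fun x => LinearMap.congr_fun hq x
  have hpow : ∀ (M : ℕ) x, (a ^ M) (ι x) = ι ((r ^ M) x) := by
    intro M
    induction M with
    | zero => intro x; simp
    | succ M ih => intro x; rw [pow_succ, pow_succ, Module.End.mul_apply, Module.End.mul_apply,
        haι', ih]
  have hqι : ∀ x, q (ι x) = (r ^ N) x := fun x => hι (by rw [hq', hpow])
  have hqa : ∀ x, q (a x) = r (q x) := fun x => hι (by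
    rw [hq', ← haι', hq', ← Module.End.mul_apply, ← Module.End.mul_apply, ← pow_succ,
      ← pow_succ'])
  have hcomm : Commute r s := hrs.trans hsr.symm
  have hrsN : r ^ N * s ^ N = 1 := by rw [← hcomm.mul_pow, hrs, one_pow]
  have hsrN : s ^ N * r ^ N = 1 := by rw [← hcomm.symm.mul_pow, hsr, one_pow]
  have hrsN' : ∀ x, (r ^ N) ((s ^ N) x) = x := fun x => LinearMap.congr_fun hrsN x
  have hcN : ∀ x, (s ^ N) (r x) = r ((s ^ N) x) := fun x =>
    LinearMap.congr_fun ((hcomm.pow_right N).eq.symm) x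
  -- The Fitting projection onto the image of `ι`: it commutes with `a`, and `a` is nilpotent on its
  -- kernel, so `a` and `a * e` have equal traces.
  set e : E →ₗ[k] E := ι ∘ₗ (s ^ N) ∘ₗ q with he
  have hea : Commute a (1 - e) := by
    apply Commute.sub_right (Commute.one_right a)
    ext x
    simp [he, hqa, haι', hcN]
  have hNe : a ^ N * (1 - e) = 0 := by
    ext x
    simp [he, mul_sub, hpow, hrsN', ← hq']
  have hnil : IsNilpotent (a * (1 - e)) := by
    refine ⟨N + 1, ?_⟩
    rw [hea.mul_pow, pow_succ' a, pow_succ' (1 - e), mul_assoc, ← mul_assoc (a ^ N), hNe]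
    simp
  have h0 := (LinearMap.isNilpotent_trace_of_isNilpotent hnil).eq_zero
  rw [mul_sub, mul_one, map_sub, sub_eq_zero] at h0
  rw [h0]
  have h1 : a * e = ι ∘ₗ (r ∘ₗ (s ^ N) ∘ₗ q) := by
    ext x
    simp [he, haι']
  rw [h1, LinearMap.trace_comp_comm']
  congr 1
  ext x
  simp only [LinearMap.comp_apply, hqι]
  have := LinearMap.congr_fun hsrN x
  simp only [Module.End.mul_apply, Module.End.one_apply] at this
  rw [this]

end LinearAlgebra

/-! ### Collapsing maps, generation in bounded degree, and traces of endomorphisms in `𝒩`. -/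

namespace NCFinSet

theorem Hom.ext_of_injective {X Y : Type} {f g : Hom X Y} (h : f.toFun = g.toFun)
    (hf : Function.Injective f.toFun) : f = g := by
  refine Hom.ext h ?_
  funext x x'
  apply propext
  constructor
  · intro hl
    obtain rfl := hf (f.map_eq_of_le hl)
    exact g.le_refl _
  · intro hl
    obtain rfl := hf (h ▸ g.map_eq_of_le hl)
    exact f.le_refl _

instance {X Y : Type} [Finite X] [Finite Y] : Finite (Hom X Y) :=
  Finite.of_injective (fun f : Hom X Y => (f.toFun, f.le)) fun f g h => by
    simp only [Prod.mk.injEq] at h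
    exact Hom.ext h.1 h.2

/-- A map out of a linearly ordered set, each fibre carrying the induced order. -/
def Hom.ofMap {X Y : Type} [LinearOrder X] (t : X → Y) : Hom X Y where
  toFun := t
  le x x' := t x = t x' ∧ x ≤ x'
  map_eq_of_le h := h.1
  le_refl _ := ⟨rfl, le_rfl⟩
  le_trans h h' := ⟨h.1.trans h'.1, h.2.trans h'.2⟩
  le_antisymm h h' := _root_.le_antisymm h.2 h'.2
  le_total {x x'} h := (_root_.le_total x x').imp (fun h' => ⟨h, h'⟩) (fun h' => ⟨h.symm, h'⟩)

/-- An injective map, each fibre carrying its unique order. -/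
def Hom.ofInjective {X Y : Type} (t : X → Y) (ht : Function.Injective t) : Hom X Y where
  toFun := t
  le x x' := x = x'
  map_eq_of_le h := congrArg t h
  le_refl _ := rfl
  le_trans h h' := h.trans h'
  le_antisymm h _ := h
  le_total h := Or.inl (ht h)

/-- Restriction of the target to a subset that contains the image. -/
def Hom.codRestrict {X Y : Type} (f : Hom X Y) (p : Y → Prop) (hp : ∀ x, p (f.toFun x)) :
    Hom X {y // p y} where
  toFun x := ⟨f.toFun x, hp x⟩
  le := f.le
  map_eq_of_le h := Subtype.ext (f.map_eq_of_le h)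
  le_refl := f.le_refl
  le_trans := f.le_trans
  le_antisymm := f.le_antisymm
  le_total h := f.le_total (congrArg Subtype.val h)

theorem Hom.codRestrict_comp {X Y : Type} (f : Hom X Y) (p : Y → Prop)
    (hp : ∀ x, p (f.toFun x)) :
    (f.codRestrict p hp).comp (Hom.ofInjective Subtype.val Subtype.val_injective) = f := by
  refine Hom.ext rfl ?_
  funext x x'
  apply propext
  simp only [Hom.comp, Hom.codRestrict, Hom.ofInjective, Subtype.mk.injEq]
  constructor
  · rintro (⟨h, hn⟩ | ⟨-, h⟩)
    · exact absurd (Subtype.ext h) hn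
    · exact h
  · exact fun h => Or.inr ⟨f.map_eq_of_le h, h⟩

/-- The endomorphism that moves all points of `T` to `b`, fibres ordered by the order of `Y`. -/
def Hom.collapse {Y : Type} [LinearOrder Y] (T : Finset Y) (b : Y) : Hom Y Y :=
  Hom.ofMap fun y => if y ∈ T then b else y

/-- The fibre orders of a collapse come from the fixed order of `Y`, so the composite sees `T` only
through the image of `g`, orders included. -/
theorem Hom.comp_collapse_congr {X Y : Type} [LinearOrder Y] (g : Hom X Y) {T T' : Finset Y}
    (b : Y) (h : ∀ x, g.toFun x ∈ T ↔ g.toFun x ∈ T') :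
    g.comp (Hom.collapse T b) = g.comp (Hom.collapse T' b) := by
  refine Hom.ext ?_ ?_
  · funext x
    simp only [Hom.comp, Hom.collapse, Hom.ofMap, h]
  · funext x x'
    simp only [Hom.comp, Hom.collapse, Hom.ofMap, h]

section Functor

variable {k : Type u} [Field k] (V : NCFinSet ⥤ ModuleCat.{w} k)

/-- The value of an `𝒩`-representation on a finite type. -/
abbrev val (Y : Type) [Finite Y] : ModuleCat.{w} k := V.obj ⟨Y⟩

/-- The linear map induced by a morphism of `𝒩`. -/
def lmap {X Y : Type} [Finite X] [Finite Y] (f : Hom X Y) : val V X →ₗ[k] val V Y :=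
  (V.map (X := ⟨X⟩) (Y := ⟨Y⟩) f).hom

theorem lmap_comp {X Y Z : Type} [Finite X] [Finite Y] [Finite Z] (f : Hom X Y) (g : Hom Y Z) :
    lmap V (f.comp g) = lmap V g ∘ₗ lmap V f := by
  have := V.map_comp (X := ⟨X⟩) (Y := ⟨Y⟩) (Z := ⟨Z⟩) f g
  exact congrArg ModuleCat.Hom.hom this

theorem lmap_id {X : Type} [Finite X] :
    lmap V (Hom.ofEquiv (Equiv.refl X)) = LinearMap.id := by
  have := V.map_id ⟨X⟩
  exact congrArg ModuleCat.Hom.hom this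

theorem lmap_ofEquiv_comp {X Y Z : Type} [Finite X] [Finite Y] [Finite Z] (e : X ≃ Y)
    (e' : Y ≃ Z) : lmap V (Hom.ofEquiv e') ∘ₗ lmap V (Hom.ofEquiv e) =
      lmap V (Hom.ofEquiv (e.trans e')) := by
  rw [← lmap_comp, Hom.ofEquiv_comp]

/-- The trace of a permutation on the value of an `𝒩`-representation. -/
noncomputable def permTrace {Y : Type} [Finite Y] (ρ : Equiv.Perm Y) : k :=
  LinearMap.trace k _ (lmap V (Hom.ofEquiv ρ))

/-- Every value of `V` is spanned by the images of the values at sets with at most `d`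
elements. -/
def GeneratedInDegree (d : ℕ) : Prop :=
  ∀ (Y : Type) [Finite Y] (W : Submodule k (val V Y)),
    (∀ (X : Type) [Finite X], Nat.card X ≤ d → ∀ (g : Hom X Y) (x : val V X),
      lmap V g x ∈ W) → W = ⊤

variable {V}

theorem mem_span_of_generators {m : ℕ} {c : Fin m → NCFinSet} {x : ∀ i, V.obj (c i)}
    (h : ∀ W : FunctorSubrep V, (∀ i, x i ∈ W.space (c i)) → ∀ d : NCFinSet, W.space d = ⊤)
    (Y : NCFinSet) :
    Submodule.span k (Set.range fun p : Σ i, (c i ⟶ Y) => (V.map p.2).hom (x p.1)) = ⊤ := by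
  let W : FunctorSubrep V :=
    { space := fun Y => Submodule.span k
        (Set.range fun p : Σ i, (c i ⟶ Y) => (V.map p.2).hom (x p.1))
      map_mem := by
        intro Y Z f y hy
        induction hy using Submodule.span_induction with
        | mem y hy =>
          obtain ⟨⟨i, g⟩, rfl⟩ := hy
          refine Submodule.subset_span ⟨⟨i, g ≫ f⟩, ?_⟩
          simp
        | zero => simp
        | add y z _ _ hy hz => rw [map_add]; exact Submodule.add_mem _ hy hz
        | smul a y _ hy => rw [map_smul]; exact Submodule.smul_mem _ _ hy }
  refine h W (fun i => Submodule.subset_span ⟨⟨i, 𝟙 _⟩, ?_⟩) Y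
  simp

theorem finiteDimensional_of_finitelyGenerated (hV : FunctorFinitelyGenerated V)
    (Y : NCFinSet) : FiniteDimensional k (V.obj Y) := by
  obtain ⟨m, c, x, h⟩ := hV
  have hs := mem_span_of_generators h Y
  have : ∀ i, Finite (c i ⟶ Y) := fun i => by
    have := (c i).finite
    have := Y.finite
    exact inferInstanceAs (Finite (Hom (c i).carrier Y.carrier))
  exact Module.finite_def.2 ((Submodule.fg_def).2 ⟨_, Set.finite_range _, hs⟩)

theorem exists_generatedInDegree (hV : FunctorFinitelyGenerated V) :
    ∃ d, GeneratedInDegree V d := by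
  obtain ⟨m, c, x, h⟩ := hV
  refine ⟨Finset.univ.sup fun i => Nat.card (c i).carrier, ?_⟩
  intro Y _ W hW
  rw [eq_top_iff, ← mem_span_of_generators h ⟨Y⟩, Submodule.span_le]
  rintro _ ⟨⟨i, g⟩, rfl⟩
  have := (c i).finite
  exact hW (c i).carrier (Finset.le_sup (f := fun i => Nat.card (c i).carrier)
    (Finset.mem_univ i)) g (x i)

/-- The terms of `T` and `insert z T` cancel. -/
theorem sum_powerset_neg_one_pow_smul_eq_zero {α M : Type*} [AddCommGroup M]
    [DecidableEq α] (Z : Finset α) (z : α) (hz : z ∈ Z) (u : Finset α → M)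
    (hu : ∀ T, z ∉ T → u (insert z T) = u T) :
    ∑ T ∈ Z.powerset, (-1 : ℤ) ^ T.card • u T = 0 := by
  rw [← Finset.insert_erase hz, Finset.sum_powerset_insert (Finset.notMem_erase z Z),
    ← Finset.sum_add_distrib]
  refine Finset.sum_eq_zero fun T hT => ?_
  have hzT : z ∉ T := fun h => Finset.notMem_erase z Z (Finset.mem_powerset.1 hT h)
  rw [Finset.card_insert_of_notMem hzT, hu T hzT, pow_succ]
  simp

/-- It suffices to kill the images of sets with at most `d` elements. Such an image misses a point
of `Z`, and adding that point to `T` changes only the sign. -/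
theorem alternating_sum_collapse {d : ℕ} (hd : GeneratedInDegree V d) {Y : Type} [Finite Y]
    [LinearOrder Y] (Z : Finset Y) (hZ : d < Z.card) (b : Y) :
    ∑ T ∈ Z.powerset, (-1 : ℤ) ^ T.card • lmap V (Hom.collapse T b) = 0 := by
  have key := hd Y (LinearMap.ker (∑ T ∈ Z.powerset, (-1 : ℤ) ^ T.card •
    lmap V (Hom.collapse T b))) ?_
  · exact LinearMap.ker_eq_top.1 key
  intro X _ hX g x
  obtain ⟨z, hzZ, hz⟩ : ∃ z ∈ Z, z ∉ Set.range g.toFun := by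
    by_contra! hcon
    have h1 : (Z : Set Y) ⊆ Set.range g.toFun := hcon
    have h2 := Set.ncard_le_ncard h1 (Set.toFinite _)
    rw [Set.ncard_coe_finset, ← Set.image_univ] at h2
    have h3 := Set.ncard_image_le (f := g.toFun) (Set.toFinite (Set.univ : Set X))
    rw [Set.ncard_univ] at h3
    omega
  rw [LinearMap.mem_ker, LinearMap.sum_apply]
  simp only [LinearMap.smul_apply]
  refine sum_powerset_neg_one_pow_smul_eq_zero Z z hzZ _ fun T _ => ?_
  rw [← LinearMap.comp_apply, ← LinearMap.comp_apply, ← lmap_comp, ← lmap_comp,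
    Hom.comp_collapse_congr g]
  intro x
  rw [Finset.mem_insert, or_iff_right]
  rintro rfl
  exact hz ⟨x, rfl⟩

theorem exists_lmap_pow {Y : Type} [Finite Y] (φ : Hom Y Y) (N : ℕ) :
    ∃ ψ : Hom Y Y, ψ.toFun = φ.toFun^[N] ∧ lmap V ψ = lmap V φ ^ N := by
  induction N with
  | zero => exact ⟨Hom.ofEquiv (Equiv.refl Y), rfl, by rw [lmap_id]; rfl⟩
  | succ N ih =>
    obtain ⟨ψ, h1, h2⟩ := ih
    refine ⟨φ.comp ψ, ?_, ?_⟩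
    · rw [Function.iterate_succ, ← h1]; rfl
    · rw [lmap_comp, h2, pow_succ]; rfl

/-- A left inverse of `t` lifts to `𝒩`: the composite is injective, so there are no fibre orders to
compare. The left inverse exists because `X` is nonempty. -/
theorem lmap_injective {X Y : Type} [Finite X] [Finite Y] [LinearOrder Y] [Nonempty X]
    (t : X → Y) (ht : Function.Injective t) :
    Function.Injective (lmap V (Hom.ofInjective t ht)) := by
  have h : (Hom.ofInjective t ht).comp (Hom.ofMap (Function.invFun t)) =
      Hom.ofEquiv (Equiv.refl X) := by
    have h0 : ((Hom.ofInjective t ht).comp (Hom.ofMap (Function.invFun t))).toFun = id := by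
      funext x
      exact Function.leftInverse_invFun ht x
    exact Hom.ext_of_injective h0 (h0 ▸ Function.injective_id)
  have h2 := lmap_comp V (Hom.ofInjective t ht) (Hom.ofMap (Function.invFun t))
  rw [h, lmap_id] at h2
  exact Function.LeftInverse.injective (g := lmap V (Hom.ofMap (Function.invFun t)))
    fun x => (LinearMap.congr_fun h2 x).symm

/-- The trace of an endomorphism of `𝒩` is the trace of the permutation that it induces on its
eventual image. -/
theorem trace_lmap_eq_permTrace (hfin : ∀ X : NCFinSet, FiniteDimensional k (V.obj X))
    {Y : Type} [Finite Y] [LinearOrder Y] (φ : Hom Y Y) (p : Y → Prop)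
    [Nonempty {y // p y}] (ρ : Equiv.Perm {y // p y})
    (hρ : ∀ y, φ.toFun y.1 = (ρ y).1) (hev : ∀ y, ∃ n, p (φ.toFun^[n] y)) :
    LinearMap.trace k _ (lmap V φ) = permTrace V ρ := by
  have hp : ∀ y, p y → p (φ.toFun y) := fun y hy => by rw [hρ ⟨y, hy⟩]; exact (ρ ⟨y, hy⟩).2
  have hmono : ∀ y m n, m ≤ n → p (φ.toFun^[m] y) → p (φ.toFun^[n] y) := by
    intro y m n hmn h
    induction n, hmn using Nat.le_induction with
    | base => exact h
    | succ n _ ih => rw [Function.iterate_succ_apply']; exact hp _ ih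
  obtain ⟨N, hN⟩ : ∃ N, ∀ y, p (φ.toFun^[N] y) := by
    choose n hn using hev
    cases nonempty_fintype Y
    exact ⟨Finset.univ.sup n, fun y => hmono y _ _ (Finset.le_sup (Finset.mem_univ y)) (hn y)⟩
  obtain ⟨ψ, hψ1, hψ2⟩ := exists_lmap_pow (V := V) φ N
  have hψp : ∀ y, p (ψ.toFun y) := fun y => by rw [hψ1]; exact hN y
  have := hfin ⟨Y⟩
  have := hfin ⟨{y // p y}⟩
  refine LinearMap.trace_eq_of_pow_factors _ _ (lmap V (Hom.ofEquiv ρ.symm))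
    (lmap V (Hom.ofInjective Subtype.val Subtype.val_injective)) (lmap V (ψ.codRestrict p hψp)) N
    (lmap_injective _ _) ?_ ?_ ?_ ?_
  · rw [← lmap_comp, ← lmap_comp]
    congr 1
    have h0 : ((Hom.ofEquiv ρ).comp (Hom.ofInjective Subtype.val Subtype.val_injective)).toFun =
        Subtype.val ∘ ρ := rfl
    have h1 : ((Hom.ofInjective (Subtype.val : {y // p y} → Y)
        Subtype.val_injective).comp φ).toFun = Subtype.val ∘ ρ := funext hρ
    exact Hom.ext_of_injective h1 (h1 ▸ Subtype.val_injective.comp ρ.injective)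
  · change lmap V _ ∘ₗ lmap V _ = 1
    rw [lmap_ofEquiv_comp, Equiv.symm_trans_self, lmap_id]
    rfl
  · change lmap V _ ∘ₗ lmap V _ = 1
    rw [lmap_ofEquiv_comp, Equiv.self_trans_symm, lmap_id]
    rfl
  · rw [← lmap_comp, Hom.codRestrict_comp, hψ2]

/-- Collapsing `T` and then permuting has the trace of the permutation on the complement of the
orbits that meet `T`. -/
theorem trace_collapse_comp (hfin : ∀ X : NCFinSet, FiniteDimensional k (V.obj X))
    {Y : Type} [Finite Y] [LinearOrder Y] (ρ : Equiv.Perm Y) (T : Finset Y) (b : Y)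
    (p : Y → Prop) (hp : ∀ y, p (ρ y) ↔ p y) (hb : p b) (hT : ∀ y ∈ T, ¬ p y)
    (hev : ∀ y, ¬ p y → ∃ n : ℕ, (ρ ^ n) y ∈ T) :
    LinearMap.trace k _ (lmap V ((Hom.collapse T b).comp (Hom.ofEquiv ρ))) =
      permTrace V (ρ.subtypePerm hp) := by
  have : Nonempty {y // p y} := ⟨⟨b, hb⟩⟩
  have hφ : ∀ y, ((Hom.collapse T b).comp (Hom.ofEquiv ρ)).toFun y =
    ρ (if y ∈ T then b else y) := fun y => rfl
  refine trace_lmap_eq_permTrace hfin _ p _ ?_ ?_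
  · rintro ⟨y, hy⟩
    rw [hφ, if_neg fun h => hT y h hy]
    rfl
  · intro y
    by_cases hy : p y
    · exact ⟨0, hy⟩
    -- A point outside `p` follows its `ρ`-orbit until it meets `T`; the next step sends it to `ρ
    -- b`, which lies in `p`.
    obtain ⟨n, hn⟩ := hev y hy
    clear hy
    induction n generalizing y with
    | zero =>
      refine ⟨1, ?_⟩
      rw [Function.iterate_one, hφ, if_pos (by simpa using hn), hp]
      exact hb
    | succ n ih =>
      by_cases hyT : y ∈ T
      · refine ⟨1, ?_⟩
        rw [Function.iterate_one, hφ, if_pos hyT, hp]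
        exact hb
      · obtain ⟨m, hm⟩ := ih (ρ y) (by rwa [pow_succ, Equiv.Perm.mul_apply] at hn)
        refine ⟨m + 1, ?_⟩
        rw [Function.iterate_succ_apply, hφ, if_neg hyT]
        exact hm

theorem alternating_sum_trace {d : ℕ} (hd : GeneratedInDegree V d) {Y : Type} [Finite Y]
    [LinearOrder Y] (Z : Finset Y) (hZ : d < Z.card) (b : Y) (ρ : Equiv.Perm Y) :
    ∑ T ∈ Z.powerset, (-1 : ℤ) ^ T.card •
      LinearMap.trace k _ (lmap V ((Hom.collapse T b).comp (Hom.ofEquiv ρ))) = 0 := by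
  have h := congrArg (fun a => LinearMap.trace k _ (lmap V (Hom.ofEquiv ρ) ∘ₗ a))
    (alternating_sum_collapse hd Z hZ b)
  rw [LinearMap.comp_zero, map_zero] at h
  change LinearMap.trace k _ (lmap V (Hom.ofEquiv ρ) *
    ∑ T ∈ Z.powerset, (-1 : ℤ) ^ T.card • lmap V (Hom.collapse T b)) = 0 at h
  rw [Finset.mul_sum, map_sum] at h
  rw [← h]
  refine Finset.sum_congr rfl fun T _ => ?_
  rw [lmap_comp, mul_smul_comm, map_zsmul]
  rfl

theorem permTrace_conj {Y Y' : Type} [Finite Y] [Finite Y'] (e : Y ≃ Y') (ρ : Equiv.Perm Y)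
    (ρ' : Equiv.Perm Y') (h : ∀ y, ρ' (e y) = e (ρ y)) : permTrace V ρ' = permTrace V ρ := by
  have h1 : ρ' = (e.symm.trans ρ).trans e := by
    ext y
    rw [← e.apply_symm_apply y, h]
    simp
  have h2 : lmap V (Hom.ofEquiv ρ') = lmap V (Hom.ofEquiv e) ∘ₗ lmap V (Hom.ofEquiv ρ) ∘ₗ
      lmap V (Hom.ofEquiv e.symm) := by
    rw [lmap_ofEquiv_comp, lmap_ofEquiv_comp, h1]
  let E : val V Y ≃ₗ[k] val V Y' := LinearEquiv.ofLinearMap (lmap V (Hom.ofEquiv e))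
    (lmap V (Hom.ofEquiv e.symm)) (by rw [lmap_ofEquiv_comp, Equiv.symm_trans_self, lmap_id])
    (by rw [lmap_ofEquiv_comp, Equiv.self_trans_symm, lmap_id])
  have h3 := LinearMap.trace_conj' (lmap V (Hom.ofEquiv ρ)) E
  rw [permTrace, permTrace, ← h3, h2]
  rfl

end Functor

end NCFinSet

/-! ### Cycle lengths of permutations, fixed points included. -/

namespace Equiv.Perm

variable {α β : Type*} [Fintype α] [DecidableEq α] [Fintype β] [DecidableEq β]

theorem cycleType_permCongr (e : α ≃ β) (σ : Perm α) :
    (e.permCongr σ).cycleType = σ.cycleType := by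
  let f : α ≃ Subtype (fun _ : β => True) := e.trans (Equiv.subtypeUnivEquiv fun _ => trivial).symm
  have h : e.permCongr σ = σ.extendDomain f := by
    ext b
    obtain ⟨a, rfl⟩ := e.surjective b
    have := extendDomain_apply_image σ f a
    exact (by simp : e.permCongr σ (e a) = e (σ a)).trans this.symm
  rw [h, cycleType_extendDomain]

theorem parts_partition_eq (σ : Perm α) : σ.partition.parts =
    σ.cycleType + Multiset.replicate (Fintype.card α - σ.cycleType.sum) 1 := by
  rw [parts_partition, sum_cycleType]

theorem parts_partition_congr (e : α ≃ β) (σ : Perm α) (τ : Perm β)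
    (h : ∀ a, τ (e a) = e (σ a)) : τ.partition.parts = σ.partition.parts := by
  have hτ : τ = e.permCongr σ := by
    ext b
    obtain ⟨a, rfl⟩ := e.surjective b
    simp [h]
  rw [parts_partition_eq, parts_partition_eq, hτ, cycleType_permCongr, Fintype.card_congr e]

theorem exists_conj_of_parts_partition_eq {σ : Perm α} {τ : Perm β}
    (h : σ.partition.parts = τ.partition.parts) : ∃ e : α ≃ β, ∀ a, τ (e a) = e (σ a) := by
  have hc : Fintype.card α = Fintype.card β := by
    rw [← σ.partition.parts_sum, ← τ.partition.parts_sum, h]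
  let e := Fintype.equivOfCardEq hc
  have h1 : IsConj (e.permCongr σ) τ := by
    rw [partition_eq_of_isConj, Nat.Partition.ext_iff, ← h]
    exact parts_partition_congr e _ _ fun a => by simp
  obtain ⟨g, hg⟩ := isConj_iff.1 h1
  refine ⟨e.trans g, fun a => ?_⟩
  rw [← hg]
  simp

theorem cycleType_sumCongr (σ : Perm α) (τ : Perm β) :
    (sumCongr σ τ).cycleType = σ.cycleType + τ.cycleType := by
  have h1 : sumCongr σ (1 : Perm β) =
      σ.extendDomain (Equiv.ofInjective (Sum.inl : α → α ⊕ β) Sum.inl_injective) := by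
    ext x
    rcases x with a | b
    · exact (extendDomain_apply_image σ
        (Equiv.ofInjective (Sum.inl : α → α ⊕ β) Sum.inl_injective) a).symm
    · rw [extendDomain_apply_not_subtype _ _ (by simp)]
      rfl
  have h2 : sumCongr (1 : Perm α) τ =
      τ.extendDomain (Equiv.ofInjective (Sum.inr : β → α ⊕ β) Sum.inr_injective) := by
    ext x
    rcases x with a | b
    · rw [extendDomain_apply_not_subtype _ _ (by simp)]
      rfl
    · exact (extendDomain_apply_image τ
        (Equiv.ofInjective (Sum.inr : β → α ⊕ β) Sum.inr_injective) b).symm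
  have h3 : sumCongr σ τ = sumCongr σ 1 * sumCongr 1 τ := by
    rw [sumCongr_mul, mul_one, one_mul]
  have h4 : Disjoint (sumCongr σ (1 : Perm β)) (sumCongr (1 : Perm α) τ) := by
    rintro (a | b)
    · exact Or.inr rfl
    · exact Or.inl rfl
  rw [h3, h4.cycleType_mul, h1, h2, cycleType_extendDomain, cycleType_extendDomain]

theorem parts_partition_sumCongr (σ : Perm α) (τ : Perm β) :
    (sumCongr σ τ).partition.parts = σ.partition.parts + τ.partition.parts := by
  rw [parts_partition_eq, parts_partition_eq, parts_partition_eq, cycleType_sumCongr,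
    Fintype.card_sum, Multiset.sum_add, add_add_add_comm, ← Multiset.replicate_add]
  have h1 := σ.sum_cycleType_le
  have h2 := τ.sum_cycleType_le
  congr 2
  omega

theorem parts_partition_finRotate (n : ℕ) [NeZero n] : (finRotate n).partition.parts = {n} := by
  rw [parts_partition_eq, Fintype.card_fin]
  match n, ‹NeZero n› with
  | 1, _ => simp [Subsingleton.elim (finRotate 1) 1]
  | n + 2, _ => simp [cycleType_finRotate]

theorem parts_partition_isEmpty [IsEmpty α] (σ : Perm α) : σ.partition.parts = 0 := by
  rw [parts_partition_eq, Subsingleton.elim σ 1]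
  simp

/-- The permutation of a disjoint union of standard cycles of lengths `l i`. -/
def rotations {I : Type*} (l : I → ℕ+) : Perm (Σ i, Fin (l i)) :=
  Equiv.sigmaCongrRight fun i => finRotate (l i)

theorem parts_partition_rotations {I : Type*} [Fintype I] [DecidableEq I] (l : I → ℕ+) :
    (rotations l).partition.parts = Finset.univ.val.map fun i => (l i : ℕ) := by
  classical
  refine Fintype.induction_empty_option (P := fun I _ => ∀ l : I → ℕ+, ∀ _ : DecidableEq I,
    (rotations l).partition.parts = Finset.univ.val.map fun i => (l i : ℕ)) ?_ ?_ ?_ I l _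
  · intro α β _ e ih l _
    let := Fintype.ofEquiv β e.symm
    let : DecidableEq α := Classical.decEq α
    have he : (Finset.univ : Finset α).val.map e = (Finset.univ : Finset β).val :=
      congrArg Finset.val (Finset.map_univ_equiv e)
    rw [← he, Multiset.map_map]
    have ih' := ih (l ∘ e) inferInstance
    refine Eq.trans ?_ (ih'.trans ?_)
    · refine parts_partition_congr (Equiv.sigmaCongrLeft (β := fun b => Fin (l b)) e) _ _ ?_
      rintro ⟨a, x⟩
      rfl
    · congr!
  · intro l _
    rw [parts_partition_isEmpty]
    rfl
  · intro I _ ih l _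
    let : DecidableEq I := Classical.decEq I
    let e : Fin (l none) ⊕ (Σ i, Fin (l (some i))) ≃ Σ i, Fin (l i) :=
      { toFun := Sum.elim (fun x => ⟨none, x⟩) fun x => ⟨some x.1, x.2⟩
        invFun := fun x => match x with
          | ⟨none, x⟩ => Sum.inl x
          | ⟨some i, x⟩ => Sum.inr ⟨i, x⟩
        left_inv := by rintro (x | x) <;> rfl
        right_inv := by rintro ⟨_ | i, x⟩ <;> rfl }
    rw [parts_partition_congr e (sumCongr (finRotate (l none)) (rotations fun i => l (some i))) _
      (by rintro (x | x) <;> rfl), parts_partition_sumCongr, parts_partition_finRotate, ih _ _]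
    have hu : (Finset.univ : Finset (Option I)).val = none ::ₘ Finset.univ.val.map some := rfl
    rw [hu, Multiset.map_cons, Multiset.map_map, Multiset.singleton_add]
    rfl

open scoped Fin.CommRing in
theorem exists_finRotate_pow_apply (n : ℕ) [NeZero n] (i j : Fin n) :
    ∃ m : ℕ, (finRotate n ^ m) i = j := by
  have h : ∀ m : ℕ, (finRotate n ^ m) i = i + (m : Fin n) := by
    intro m
    induction m with
    | zero => simp
    | succ m ih => rw [pow_succ', mul_apply, ih, finRotate_apply]; push_cast; ring
  exact ⟨(j - i : Fin n).val, by rw [h, Fin.cast_val_eq_self, add_sub_cancel]⟩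

end Equiv.Perm

/-! ### The two relations between traces. -/

namespace NCFinSet

section

variable {k : Type u} [Field k] {V : NCFinSet ⥤ ModuleCat.{w} k}

variable (V) in
open Classical in
/-- The trace on `V` of any permutation with the given multiset of cycle lengths. -/
noncomputable def partsTrace (M : Multiset ℕ) : k :=
  if h : ∃ (n : ℕ) (σ : Equiv.Perm (Fin n)), σ.partition.parts = M then
    permTrace V h.choose_spec.choose else 0

theorem permTrace_eq_partsTrace {Y : Type} [Fintype Y] [DecidableEq Y] (ρ : Equiv.Perm Y) :
    permTrace V ρ = partsTrace V ρ.partition.parts := by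
  have h : ∃ (n : ℕ) (σ : Equiv.Perm (Fin n)), σ.partition.parts = ρ.partition.parts :=
    ⟨_, (Fintype.equivFin Y).permCongr ρ,
      Equiv.Perm.parts_partition_congr (Fintype.equivFin Y) _ _ fun a => by simp⟩
  rw [partsTrace, dif_pos h]
  obtain ⟨e, he⟩ := Equiv.Perm.exists_conj_of_parts_partition_eq h.choose_spec.choose_spec
  exact permTrace_conj e _ _ he

/-- Take for `Z` the whole `j`-cycle. Every nonempty `T ⊆ Z` deletes exactly this cycle, and the
signs add up to zero, so the term of `T = ∅` must equal the common value of the others. -/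
theorem partsTrace_parts_add_singleton (hfin : ∀ X : NCFinSet, FiniteDimensional k (V.obj X))
    {d : ℕ} (hd : GeneratedInDegree V d) {B : Type} [Fintype B] [DecidableEq B] [Nonempty B]
    (β : Equiv.Perm B) (j : ℕ+) (hj : d < j) :
    partsTrace V (β.partition.parts + {(j : ℕ)}) = partsTrace V β.partition.parts := by
  classical
  -- Any order serves; it only supplies fibre orders for the collapses.
  let : LinearOrder (B ⊕ Fin j) := LinearOrder.lift' (Fintype.equivFin _) (Equiv.injective _)
  obtain ⟨b⟩ := ‹Nonempty B›
  let ρ : Equiv.Perm (B ⊕ Fin j) := Equiv.Perm.sumCongr β (finRotate j)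
  let Z : Finset (B ⊕ Fin j) := Finset.univ.map Function.Embedding.inr
  have hZ : Z.card = j := by simp [Z]
  have hsum := alternating_sum_trace hd Z (hZ.symm ▸ hj) (Sum.inl b) ρ
  have hval : ∀ T ∈ Z.powerset, (-1 : ℤ) ^ T.card •
      LinearMap.trace k _ (lmap V ((Hom.collapse T (Sum.inl b)).comp (Hom.ofEquiv ρ))) =
      (-1 : ℤ) ^ T.card • partsTrace V β.partition.parts +
      if T = ∅ then partsTrace V (β.partition.parts + {(j : ℕ)}) -
        partsTrace V β.partition.parts else 0 := by
    intro T hT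
    split_ifs with h
    · subst h
      rw [trace_collapse_comp hfin ρ ∅ (Sum.inl b) (fun _ => True) (fun _ => Iff.rfl) trivial
        (by simp) (by simp), permTrace_eq_partsTrace, Equiv.Perm.parts_partition_congr
        (Equiv.subtypeUnivEquiv fun _ => trivial).symm ρ _ (fun _ => rfl),
        Equiv.Perm.parts_partition_sumCongr, Equiv.Perm.parts_partition_finRotate]
      simp
    · obtain ⟨t, ht⟩ := Finset.nonempty_iff_ne_empty.2 h
      have hTZ : ∀ y ∈ T, ∃ i, y = Sum.inr i := fun y hy => by
        have := Finset.mem_powerset.1 hT hy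
        simp only [Z, Finset.mem_map, Finset.mem_univ, true_and] at this
        obtain ⟨i, rfl⟩ := this
        exact ⟨i, rfl⟩
      obtain ⟨i, rfl⟩ := hTZ t ht
      rw [add_zero, trace_collapse_comp hfin ρ T (Sum.inl b) (fun y => y.isLeft)
        (by rintro (y | y) <;> rfl) rfl
        (fun y hy => by obtain ⟨i, rfl⟩ := hTZ y hy; simp) ?_, permTrace_eq_partsTrace,
        Equiv.Perm.parts_partition_congr
          (⟨fun y => ⟨Sum.inl y, rfl⟩, fun y => y.1.getLeft y.2, fun _ => rfl, by
            rintro ⟨y | y, h⟩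
            · rfl
            · exact absurd h (by simp)⟩ : B ≃ {y : B ⊕ Fin j // y.isLeft}) β _ (fun _ => rfl)]
      rintro (y | y) hy
      · simp at hy
      · obtain ⟨m, hm⟩ := Equiv.Perm.exists_finRotate_pow_apply j y i
        refine ⟨m, ?_⟩
        have hpow : ∀ n : ℕ, (ρ ^ n) (Sum.inr y) = Sum.inr ((finRotate j ^ n) y) := by
          intro n
          induction n with
          | zero => rfl
          | succ n ih => rw [pow_succ', pow_succ', Equiv.Perm.mul_apply, ih]; rfl
        rwa [hpow, hm]
  rw [Finset.sum_congr rfl hval, Finset.sum_add_distrib, ← Finset.sum_smul,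
    Finset.sum_powerset_neg_one_pow_card, if_neg (Finset.card_pos.1 (by omega)).ne_empty,
    zero_smul, zero_add, Finset.sum_ite_eq' , if_pos (Finset.empty_mem_powerset _)] at hsum
  exact sub_eq_zero.1 hsum

/-- The union of `B` and of the cycles indexed by the complement of `J`. -/
def remainingEquiv {B I : Type} (l : I → ℕ+) (J : Finset I) :
    (B ⊕ Σ i : {i // i ∉ J}, Fin (l i)) ≃
      {y : B ⊕ Σ i, Fin (l i) // Sum.elim (fun _ => True) (fun x => x.1 ∉ J) y} where
  toFun y := match y with
    | Sum.inl b => ⟨Sum.inl b, trivial⟩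
    | Sum.inr ⟨i, x⟩ => ⟨Sum.inr ⟨i, x⟩, i.2⟩
  invFun y := match y with
    | ⟨Sum.inl b, _⟩ => Sum.inl b
    | ⟨Sum.inr ⟨i, x⟩, h⟩ => Sum.inr ⟨⟨i, h⟩, x⟩
  left_inv := by rintro (b | ⟨i, x⟩) <;> rfl
  right_inv := by rintro ⟨b | ⟨i, x⟩, h⟩ <;> rfl

/-- Mark the point `0` in each cycle `Fin (l i)` and let `Z` be the set of marked points: collapsing
those indexed by `J` deletes exactly the cycles in `J`. -/
theorem alternating_sum_partsTrace_compl
    (hfin : ∀ X : NCFinSet, FiniteDimensional k (V.obj X))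
    {d : ℕ} (hd : GeneratedInDegree V d) {B : Type} [Fintype B] [DecidableEq B] [Nonempty B]
    (β : Equiv.Perm B) {I : Type} [Fintype I] [DecidableEq I] (l : I → ℕ+)
    (hI : d < Fintype.card I) :
    ∑ J : Finset I, (-1 : ℤ) ^ J.card •
      partsTrace V (β.partition.parts + Jᶜ.val.map fun i => (l i : ℕ)) = 0 := by
  classical
  let : LinearOrder (B ⊕ Σ i, Fin (l i)) :=
    LinearOrder.lift' (Fintype.equivFin _) (Equiv.injective _)
  obtain ⟨b⟩ := ‹Nonempty B›
  let ρ : Equiv.Perm (B ⊕ Σ i, Fin (l i)) :=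
    Equiv.Perm.sumCongr β (Equiv.Perm.rotations l)
  let em : I ↪ B ⊕ Σ i, Fin (l i) := ⟨fun i => Sum.inr ⟨i, 0⟩, fun i i' h => by
    simpa using congrArg (Sum.elim (fun _ => none) fun x => some x.1) h⟩
  have hsum := alternating_sum_trace hd (Finset.univ.map em)
    (by rwa [Finset.card_map, Finset.card_univ]) (Sum.inl b) ρ
  have hps : (Finset.univ.map em).powerset =
      (Finset.univ : Finset (Finset I)).map (Finset.mapEmbedding em).toEmbedding := by
    ext T
    simp [Finset.subset_map_iff, eq_comm]
  rw [hps, Finset.sum_map] at hsum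
  rw [← hsum]
  refine Finset.sum_congr rfl fun J _ => ?_
  change _ = (-1 : ℤ) ^ (J.map em).card • LinearMap.trace k _
    (lmap V ((Hom.collapse (J.map em) (Sum.inl b)).comp (Hom.ofEquiv ρ)))
  rw [Finset.card_map]
  congr 1
  rw [trace_collapse_comp hfin ρ (J.map em) (Sum.inl b)
    (Sum.elim (fun _ => True) fun x => x.1 ∉ J) (by rintro (y | y) <;> rfl) trivial
    (by
      intro y hy
      obtain ⟨i, hi, rfl⟩ := Finset.mem_map.1 hy
      exact not_not.2 hi) ?_, permTrace_eq_partsTrace,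
    Equiv.Perm.parts_partition_congr (remainingEquiv l J)
      (Equiv.Perm.sumCongr β (Equiv.Perm.rotations fun i : {i // i ∉ J} => l i)) _
      (by rintro (y | y) <;> rfl), Equiv.Perm.parts_partition_sumCongr,
    Equiv.Perm.parts_partition_rotations]
  · have hm : (Finset.univ : Finset {i // i ∉ J}).val.map Subtype.val = Jᶜ.val := by
      have : (Finset.univ : Finset {i // i ∉ J}).map (Function.Embedding.subtype _) = Jᶜ := by
        ext i
        simp
      exact congrArg Finset.val this
    rw [← hm, Multiset.map_map]
    rfl
  · rintro (y | ⟨i, x⟩) hy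
    · simp at hy
    · have hi : i ∈ J := by simpa using hy
      obtain ⟨m, hm⟩ := Equiv.Perm.exists_finRotate_pow_apply (l i) x 0
      refine ⟨m, ?_⟩
      have hpow : ∀ n : ℕ, (ρ ^ n) (Sum.inr ⟨i, x⟩) = Sum.inr ⟨i, (finRotate (l i) ^ n) x⟩ := by
        intro n
        induction n with
        | zero => rfl
        | succ n ih => rw [pow_succ', pow_succ', Equiv.Perm.mul_apply, ih]; rfl
      rw [hpow, hm]
      exact Finset.mem_map_of_mem em hi

theorem alternating_sum_partsTrace
    (hfin : ∀ X : NCFinSet, FiniteDimensional k (V.obj X))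
    {d : ℕ} (hd : GeneratedInDegree V d) {B : Type} [Fintype B] [DecidableEq B] [Nonempty B]
    (β : Equiv.Perm B) {I : Type} [Fintype I] [DecidableEq I] (l : I → ℕ+)
    (hI : d < Fintype.card I) :
    ∑ J : Finset I, (-1 : ℤ) ^ J.card •
      partsTrace V (β.partition.parts + J.val.map fun i => (l i : ℕ)) = 0 := by
  have h := alternating_sum_partsTrace_compl hfin hd β l hI
  rw [← (Equiv.ofBijective _ (compl_bijective (α := Finset I))).sum_comp] at h
  simp only [Equiv.ofBijective_apply, compl_compl] at h
  have h2 := congrArg (fun x => (-1 : ℤ) ^ Fintype.card I • x) h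
  simp only [smul_zero, Finset.smul_sum, smul_smul, ← pow_add] at h2
  rw [← h2]
  refine Finset.sum_congr rfl fun J _ => ?_
  congr 1
  rw [Finset.card_compl]
  have := Finset.card_le_univ J
  rw [show Fintype.card I + (Fintype.card I - J.card) = J.card + 2 * (Fintype.card I - J.card) by
    omega, pow_add, pow_mul]
  simp

end

end NCFinSet

/-! ### Rationality of the characters of symmetric groups. -/

theorem Equiv.Perm.cycleType_pow_of_coprime {α : Type*} [Fintype α] [DecidableEq α]
    (σ : Equiv.Perm α) {n : ℕ} (hn : n.Coprime (orderOf σ)) :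
    (σ ^ n).cycleType = σ.cycleType := by
  induction σ using Equiv.Perm.cycle_induction_on with
  | base_one => simp
  | base_cycles σ hσ =>
    rw [(hσ.pow_iff.2 hn).cycleType, hσ.cycleType, Equiv.Perm.support_pow_coprime hn]
  | induction_disjoint σ τ hd _ hσ hτ =>
    rw [hd.orderOf] at hn
    rw [hd.commute.mul_pow, (hd.pow_disjoint_pow n n).cycleType_mul, hd.cycleType_mul,
      hσ (hn.coprime_dvd_right (Nat.dvd_lcm_left _ _)),
      hτ (hn.coprime_dvd_right (Nat.dvd_lcm_right _ _))]

/-- The characters of a symmetric group in characteristic zero are rational. -/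
theorem Equiv.Perm.exists_rat_eq_character {k : Type*} [Field k] [CharZero k] {α : Type*}
    [Fintype α] [DecidableEq α] {E : Type*} [AddCommGroup E] [Module k E] [FiniteDimensional k E]
    (ρ : Representation k (Equiv.Perm α) E) (σ : Equiv.Perm α) :
    ∃ q : ℚ, ρ.character σ = q := by
  classical
  induction hN : orderOf σ using Nat.strong_induction_on generalizing σ with
  | _ N ih =>
  subst hN
  -- Over the cyclic group of `σ` the character sums to an integer. Its generators are conjugate to
  -- `σ` and contribute a positive multiple of the unknown value; the other elements have smaller
  -- order and rational values by induction.
  let ρ' : Representation k (Subgroup.zpowers σ) E := ρ.comp (Subgroup.zpowers σ).subtype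
  have : Invertible (Nat.card (Subgroup.zpowers σ) : k) :=
    invertibleOfNonzero (by simp)
  have hsum := ρ'.card_inv_mul_sum_char_eq_finrank
  rw [inv_mul_eq_iff_eq_mul₀ (by simp)] at hsum
  rw [← Finset.sum_filter_add_sum_filter_not _ fun g => orderOf g.1 = orderOf σ] at hsum
  have h1 : ∀ g ∈ Finset.univ.filter fun g : Subgroup.zpowers σ => orderOf g.1 = orderOf σ,
      ρ'.character g = ρ.character σ := by
    rintro ⟨g, hg⟩ ho
    obtain ⟨n, rfl⟩ := (isOfFinOrder_of_finite σ).mem_powers_iff_mem_zpowers.2 hg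
    simp only [Finset.mem_filter, Finset.mem_univ, true_and] at ho
    have hc : n.Coprime (orderOf σ) := by
      rw [orderOf_pow] at ho
      have := (Nat.div_eq_self.1 ho).resolve_left (orderOf_pos σ).ne'
      exact (Nat.coprime_comm).1 this
    obtain ⟨g, hg⟩ := isConj_iff.1
      (Equiv.Perm.isConj_of_cycleType_eq (σ.cycleType_pow_of_coprime hc).symm)
    change ρ.character (σ ^ n) = _
    rw [← hg, Representation.char_conj]
  have h2 : ∀ g : Subgroup.zpowers σ, ∃ q : ℚ, orderOf g.1 ≠ orderOf σ →
      ρ'.character g = q := by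
    rintro ⟨g, hg⟩
    by_cases ho : orderOf g = orderOf σ
    · exact ⟨0, fun h => absurd ho h⟩
    · obtain ⟨q, hq⟩ := ih (orderOf g)
        (lt_of_le_of_ne (Nat.le_of_dvd (orderOf_pos σ) (orderOf_dvd_of_mem_zpowers hg)) ho) g rfl
      exact ⟨q, fun _ => hq⟩
  choose q hq using h2
  rw [Finset.sum_congr rfl h1, Finset.sum_const, Finset.sum_congr rfl
    fun g hg => hq g (Finset.mem_filter.1 hg).2, nsmul_eq_mul] at hsum
  set c := (Finset.univ.filter fun g : Subgroup.zpowers σ => orderOf g.1 = orderOf σ).card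
  have hc : (c : k) ≠ 0 := by
    rw [Nat.cast_ne_zero, ← Nat.pos_iff_ne_zero, Finset.card_pos]
    exact ⟨⟨σ, Subgroup.mem_zpowers σ⟩, Finset.mem_filter.2 ⟨Finset.mem_univ _, rfl⟩⟩
  refine ⟨(Nat.card (Subgroup.zpowers σ) * Module.finrank k ρ'.invariants -
    ∑ g : Subgroup.zpowers σ with orderOf g.1 ≠ orderOf σ, q g) / c, ?_⟩
  push_cast
  rw [eq_div_iff hc, ← hsum]
  ring

namespace NCFinSet

theorem exists_rat_eq_partsTrace {k : Type u} [Field k] [CharZero k]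
    {V : NCFinSet ⥤ ModuleCat.{w} k} (hfin : ∀ X : NCFinSet, FiniteDimensional k (V.obj X))
    (M : Multiset ℕ) : ∃ q : ℚ, partsTrace V M = q := by
  rw [partsTrace]
  split_ifs with h
  · have := hfin (std h.choose)
    exact Equiv.Perm.exists_rat_eq_character (symmRep V h.choose) h.choose_spec.choose
  · exact ⟨0, by simp⟩

end NCFinSet

/-! ### Finite differences on multisets, and polynomials in the multiplicities. -/

namespace Multiset

section Mobius

variable {α R : Type*} [CommRing R]

/-- The alternating sum of a function over the sub-multisets of `A`. -/
def mobius (H : Multiset α → R) (A : Multiset α) : R :=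
  (-1) ^ card A * (A.powerset.map fun B => (-1) ^ card B * H B).sum

/-- As `powerset` counts sub-multisets with multiplicity, `mobius H A` is the iterated difference of
`H` at `0`, with one step in direction `a` for each occurrence of `a` in `A`. -/
theorem mobius_cons (H : Multiset α → R) (a : α) (A : Multiset α) :
    mobius H (a ::ₘ A) = mobius (fun B => H (a ::ₘ B)) A - mobius H A := by
  simp only [mobius, powerset_cons, map_add, sum_add, map_map, Function.comp_def, card_cons,
    pow_succ]
  have h : (A.powerset.map fun B => (-1) ^ card B * -1 * H (a ::ₘ B)).sum =
      -(A.powerset.map fun B => (-1) ^ card B * H (a ::ₘ B)).sum := by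
    rw [← sum_map_neg]
    refine congrArg sum (map_congr rfl fun B _ => ?_)
    ring
  rw [h]
  ring

/-- Newton's forward difference formula; by `count_powerset`, the coefficients are products of
binomials in the multiplicities. -/
theorem sum_powerset_mobius (H : Multiset α → R) (M : Multiset α) :
    (M.powerset.map (mobius H)).sum = H M := by
  induction M using Multiset.induction generalizing H with
  | empty => simp [mobius]
  | cons a M ih =>
    rw [powerset_cons, map_add, sum_add, map_map, ← ih fun B => H (a ::ₘ B), ← sum_map_add]
    refine congrArg sum (map_congr rfl fun A _ => ?_)
    simp [mobius_cons]

theorem count_powerset [DecidableEq α] (S : Finset α) (A M : Multiset α) (hA : ∀ a ∈ A, a ∈ S) :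
    M.powerset.count A = ∏ j ∈ S, (M.count j).choose (A.count j) := by
  induction M using Multiset.induction generalizing A with
  | empty =>
    rcases eq_or_ne A 0 with rfl | h
    · simp
    · obtain ⟨a, ha⟩ := exists_mem_of_ne_zero h
      rw [Finset.prod_eq_zero (hA a ha), powerset_zero, count_singleton, if_neg h]
      rw [count_zero, Nat.choose_eq_zero_of_lt (count_pos.2 ha)]
  | cons a M ih =>
    rw [powerset_cons, count_add, ih A hA]
    by_cases ha : a ∈ A
    · obtain ⟨A', rfl⟩ := exists_cons_of_mem ha
      have haS := hA a ha
      rw [count_map_eq_count' _ _ (fun _ _ h => (cons_inj_right a).1 h),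
        ih A' fun b hb => hA b (mem_cons_of_mem hb), ← Finset.mul_prod_erase S _ haS,
        ← Finset.mul_prod_erase S _ haS, ← Finset.mul_prod_erase S _ haS]
      have h1 : ∀ j ∈ S.erase a, (M.count j).choose ((a ::ₘ A').count j) =
          (M.count j).choose (A'.count j) := fun j hj => by
        rw [count_cons_of_ne (Finset.ne_of_mem_erase hj)]
      have h2 : ∀ j ∈ S.erase a, ((a ::ₘ M).count j).choose ((a ::ₘ A').count j) =
          (M.count j).choose (A'.count j) := fun j hj => by
        rw [count_cons_of_ne (Finset.ne_of_mem_erase hj),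
          count_cons_of_ne (Finset.ne_of_mem_erase hj)]
      rw [Finset.prod_congr rfl h1, Finset.prod_congr rfl h2, count_cons_self, count_cons_self,
        Nat.choose_succ_succ]
      ring
    · rw [count_eq_zero_of_notMem, add_zero]
      · refine Finset.prod_congr rfl fun j _ => ?_
        rcases eq_or_ne j a with rfl | hj
        · rw [count_eq_zero_of_notMem ha, Nat.choose_zero_right, Nat.choose_zero_right]
        · rw [count_cons_of_ne hj]
      · intro h
        obtain ⟨B, -, rfl⟩ := mem_map.1 h
        exact ha (mem_cons_self a B)

theorem sum_powerset_map_val {I M : Type*} [Fintype I] [AddCommMonoid M] (l : I → α)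
    (Φ : Multiset α → M) :
    ∑ J : Finset I, Φ (J.val.map l) = ((Finset.univ.val.map l).powerset.map Φ).sum := by
  classical
  suffices h : ∀ (s : Finset I) (Φ : Multiset α → M),
      ∑ J ∈ s.powerset, Φ (J.val.map l) = ((s.val.map l).powerset.map Φ).sum by
    rw [← h, Finset.powerset_univ]
  intro s
  induction s using Finset.induction_on with
  | empty => intro Φ; simp
  | insert i s hi ih =>
    intro Φ
    rw [Finset.sum_powerset_insert hi, Finset.insert_val_of_notMem hi, map_cons, powerset_cons,
      map_add, sum_add, map_map, ih, ← Function.comp_def, ← ih (Φ ∘ cons (l i))]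
    congr 1
    refine Finset.sum_congr rfl fun J hJ => ?_
    change Φ ((insert i J).val.map l) = Φ (l i ::ₘ J.val.map l)
    rw [Finset.insert_val_of_notMem fun h => hi (Finset.mem_powerset.1 hJ h), map_cons]

end Mobius

section CharacterPolynomial

open MvPolynomial in
/-- The binomial coefficient of a variable, as a polynomial. -/
noncomputable def choosePoly (j : ℕ+) (m : ℕ) : MvPolynomial ℕ+ ℚ :=
  C ((m.factorial : ℚ)⁻¹) * Polynomial.aeval (X j) (descPochhammer ℚ m)

theorem eval_choosePoly (x : ℕ+ → ℕ) (j : ℕ+) (m : ℕ) :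
    MvPolynomial.eval (fun j => (x j : ℚ)) (choosePoly j m) = (x j).choose m := by
  rw [choosePoly, map_mul, MvPolynomial.eval_C, ← MvPolynomial.coe_aeval_eq_eval,
    RingHom.coe_coe, ← Polynomial.aeval_algHom_apply, MvPolynomial.aeval_X,
    Polynomial.coe_aeval_eq_eval, Nat.cast_choose_eq_descPochhammer_div]
  ring

/-- A function on multisets whose finite differences of high order vanish, and which ignores
large elements, is a polynomial in the multiplicities. -/
theorem exists_mvPolynomial_of_mobius_eq_zero (d : ℕ) (H : Multiset ℕ+ → ℚ)
    (hcard : ∀ A, d < card A → mobius H A = 0)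
    (hbig : ∀ (j : ℕ+) A, d < j → H (j ::ₘ A) = H A) :
    ∃ P : MvPolynomial ℕ+ ℚ, ∀ M : Multiset ℕ+,
      H M = MvPolynomial.eval (fun j => (M.count j : ℚ)) P := by
  classical
  -- A nonzero difference has at most `d` steps, all in directions at most `d`; `D` contains all
  -- such `A`. The bound `d + 1` is used because `d` may be `0`, which is not in `ℕ+`.
  let S : Finset ℕ+ := Finset.Icc 1 d.succPNat
  let D : Finset (Multiset ℕ+) := (d • S.val).powerset.toFinset
  have hD : ∀ A ∈ D, ∀ a ∈ A, a ∈ S := by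
    intro A hA a ha
    have := mem_of_le (mem_powerset.1 (mem_toFinset.1 hA)) ha
    exact (mem_nsmul.1 this).2
  have hsupp : ∀ A, A ∉ D → mobius H A = 0 := by
    intro A hA
    by_contra hne
    have h1 : card A ≤ d := not_lt.1 fun h => hne (hcard A h)
    have h2 : ∀ j ∈ A, (j : ℕ) ≤ d := by
      intro j hj
      by_contra! h
      obtain ⟨A', rfl⟩ := exists_cons_of_mem hj
      refine hne ?_
      rw [mobius_cons, sub_eq_zero]
      congr 1
      funext B
      exact hbig j B h
    refine hA (mem_toFinset.2 (mem_powerset.2 (le_iff_count.2 fun j => ?_)))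
    by_cases hj : j ∈ A
    · have hjS : j ∈ S := by
        rw [Finset.mem_Icc]
        refine ⟨one_le, ?_⟩
        rw [← PNat.coe_le_coe, Nat.succPNat_coe]
        exact (h2 j hj).trans (Nat.le_succ d)
      rw [count_nsmul, count_eq_one_of_mem S.nodup hjS, mul_one]
      exact (count_le_card j A).trans h1
    · rw [count_eq_zero_of_notMem hj]
      exact Nat.zero_le _
  refine ⟨∑ A ∈ D, MvPolynomial.C (mobius H A) * ∏ j ∈ S, choosePoly j (A.count j),
    fun M => ?_⟩
  rw [← sum_powerset_mobius H M, Finset.sum_multiset_map_count, map_sum]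
  have h1 : ∀ A, A ∉ M.powerset.toFinset → M.powerset.count A • mobius H A = 0 := fun A hA => by
    rw [count_eq_zero_of_notMem fun h => hA (mem_toFinset.2 h), zero_smul]
  have h2 : ∀ A, A ∉ D → M.powerset.count A • mobius H A = 0 := fun A hA => by
    rw [hsupp A hA, smul_zero]
  rw [Finset.sum_subset (Finset.subset_union_left (s₂ := D)) fun A _ hA => h1 A hA,
    ← Finset.sum_subset (Finset.subset_union_right (s₁ := M.powerset.toFinset))
      fun A _ hA => h2 A hA]
  refine Finset.sum_congr rfl fun A hA => ?_
  rw [map_mul, MvPolynomial.eval_C, map_prod, count_powerset S A M (hD A hA), nsmul_eq_mul,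
    mul_comm, Nat.cast_prod]
  congr 1
  exact Finset.prod_congr rfl fun j _ => (eval_choosePoly (fun j => M.count j) j _).symm

/-- For each nonempty `M` the function `T (M + ·)` is a polynomial. The one for `M = {1}`, shifted
back by one in the variable `X 1`, works whenever `1` occurs. For other `M`, compare polynomials
along the line of the `M + i • {1}`: they agree for `i ≥ 1`, hence at `i = 0`. -/
theorem exists_mvPolynomial_of_ne_zero (d : ℕ) (T : Multiset ℕ+ → ℚ)
    (hcard : ∀ M A, M ≠ 0 → d < card A → mobius (fun B => T (M + B)) A = 0)
    (hbig : ∀ (j : ℕ+) M, M ≠ 0 → d < j → T (j ::ₘ M) = T M) :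
    ∃ P : MvPolynomial ℕ+ ℚ, ∀ M : Multiset ℕ+, M ≠ 0 →
      T M = MvPolynomial.eval (fun j => (M.count j : ℚ)) P := by
  have key : ∀ M : Multiset ℕ+, M ≠ 0 → ∃ P : MvPolynomial ℕ+ ℚ, ∀ A : Multiset ℕ+,
      T (M + A) = MvPolynomial.eval (fun j => (A.count j : ℚ)) P := fun M hM =>
    exists_mvPolynomial_of_mobius_eq_zero d _ (fun A hA => hcard M A hM hA) fun j A hj => by
      rw [add_cons]
      exact hbig j _ (fun h => hM (add_eq_zero.1 h).1) hj
  obtain ⟨P₀, hP₀⟩ := key {1} (singleton_ne_zero 1)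
  let P : MvPolynomial ℕ+ ℚ := MvPolynomial.aeval
    (fun j => MvPolynomial.X j - if j = 1 then 1 else 0) P₀
  have heval : ∀ x : ℕ+ → ℚ, MvPolynomial.eval x P =
      MvPolynomial.eval (fun j => x j - if j = 1 then 1 else 0) P₀ := by
    intro x
    simp only [P, ← MvPolynomial.coe_aeval_eq_eval, RingHom.coe_coe]
    rw [← AlgHom.comp_apply, MvPolynomial.comp_aeval]
    congr! 3
    split_ifs <;> simp
  have hP : ∀ A : Multiset ℕ+, T (1 ::ₘ A) =
      MvPolynomial.eval (fun j => ((1 ::ₘ A).count j : ℚ)) P := by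
    intro A
    rw [heval, ← singleton_add, hP₀]
    congr! 3 with j
    rw [singleton_add, count_cons]
    split_ifs <;> simp
  refine ⟨P, fun M hM => ?_⟩
  obtain ⟨Q, hQ⟩ := key M hM
  let p : Polynomial ℚ := MvPolynomial.aeval (fun j => if j = 1 then Polynomial.X else 0) Q
  let q : Polynomial ℚ := MvPolynomial.aeval
    (fun j => Polynomial.C (M.count j : ℚ) + if j = 1 then Polynomial.X else 0) P
  have hp : ∀ i : ℕ, p.eval (i : ℚ) =
      MvPolynomial.eval (fun j => ((replicate i (1 : ℕ+)).count j : ℚ)) Q := by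
    intro i
    simp only [p, ← MvPolynomial.coe_aeval_eq_eval, RingHom.coe_coe,
      ← Polynomial.coe_aeval_eq_eval]
    rw [← AlgHom.comp_apply, MvPolynomial.comp_aeval]
    congr! 3 with j
    rw [count_replicate]
    by_cases hj : j = 1
    · simp [hj]
    · simp [hj, Ne.symm hj]
  have hq : ∀ i : ℕ, q.eval (i : ℚ) =
      MvPolynomial.eval (fun j => ((M + replicate i (1 : ℕ+)).count j : ℚ)) P := by
    intro i
    simp only [q, ← MvPolynomial.coe_aeval_eq_eval, RingHom.coe_coe,
      ← Polynomial.coe_aeval_eq_eval]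
    rw [← AlgHom.comp_apply, MvPolynomial.comp_aeval]
    congr! 3 with j
    rw [count_add, count_replicate]
    by_cases hj : j = 1
    · simp [hj]
    · simp [hj, Ne.symm hj]
  have hpq : p = q := by
    refine Polynomial.eq_of_infinite_eval_eq p q
      ((Set.infinite_range_of_injective (f := fun i : ℕ => ((i + 1 : ℕ) : ℚ)) fun a b h => by
        simpa using h).mono ?_)
    rintro _ ⟨i, rfl⟩
    change p.eval _ = q.eval _
    rw [hp, hq, ← hQ, replicate_succ, add_cons, hP]
  have h0 := hp 0
  rw [hpq, hq 0, replicate_zero, ← hQ, add_zero] at h0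
  exact h0.symm

end CharacterPolynomial

end Multiset

/-! ### From the trace relations to the character polynomial. -/

namespace NCFinSet

section

variable {k : Type u} [Field k] {V : NCFinSet ⥤ ModuleCat.{w} k}

theorem exists_perm_parts_partition (M : Multiset ℕ+) :
    ∃ (n : ℕ) (σ : Equiv.Perm (Fin n)), σ.partition.parts = M.map PNat.val := by
  classical
  let e := Fintype.equivFin (Σ i : M.ToType, Fin (i.1 : ℕ+))
  refine ⟨_, e.permCongr (Equiv.Perm.rotations fun i : M.ToType => i.1), ?_⟩
  rw [Equiv.Perm.parts_partition_congr e (Equiv.Perm.rotations fun i : M.ToType => i.1) _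
    (fun a => by simp), Equiv.Perm.parts_partition_rotations]
  have h := congrArg (Multiset.map PNat.val) M.map_univ_coe
  rwa [Multiset.map_map] at h

theorem nonempty_of_parts_partition_ne_zero {n : ℕ} (σ : Equiv.Perm (Fin n))
    (h : σ.partition.parts ≠ 0) : Nonempty (Fin n) := by
  by_contra hn
  rw [not_nonempty_iff] at hn
  exact h (Equiv.Perm.parts_partition_isEmpty σ)

theorem alternating_sum_powerset_partsTrace
    (hfin : ∀ X : NCFinSet, FiniteDimensional k (V.obj X)) {d : ℕ} (hd : GeneratedInDegree V d)
    (M A : Multiset ℕ+) (hM : M ≠ 0) (hA : d < Multiset.card A) :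
    (A.powerset.map fun B => (-1) ^ Multiset.card B *
      partsTrace V ((M + B).map PNat.val)).sum = 0 := by
  classical
  obtain ⟨n, σ, hσ⟩ := exists_perm_parts_partition M
  have := nonempty_of_parts_partition_ne_zero σ
    (by rw [hσ]; exact fun h => hM (Multiset.map_eq_zero.1 h))
  have h := alternating_sum_partsTrace hfin hd σ (fun i : A.ToType => i.1)
    (by rwa [Multiset.card_coe])
  rw [← h]
  have h2 := Multiset.sum_powerset_map_val (fun i : A.ToType => i.1) fun B =>
    (-1) ^ Multiset.card B * partsTrace V ((M + B).map PNat.val)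
  rw [Multiset.map_univ_coe] at h2
  rw [← h2]
  refine Finset.sum_congr rfl fun J _ => ?_
  rw [Multiset.map_add, hσ, Multiset.map_map, Multiset.card_map, zsmul_eq_mul]
  push_cast
  rfl

theorem partsTrace_cons (hfin : ∀ X : NCFinSet, FiniteDimensional k (V.obj X)) {d : ℕ}
    (hd : GeneratedInDegree V d) (j : ℕ+) (M : Multiset ℕ+) (hM : M ≠ 0) (hj : d < j) :
    partsTrace V ((j ::ₘ M).map PNat.val) = partsTrace V (M.map PNat.val) := by
  obtain ⟨n, σ, hσ⟩ := exists_perm_parts_partition M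
  have := nonempty_of_parts_partition_ne_zero σ
    (by rw [hσ]; exact fun h => hM (Multiset.map_eq_zero.1 h))
  have h := partsTrace_parts_add_singleton hfin hd σ j hj
  rwa [hσ, add_comm, Multiset.singleton_add, ← Multiset.map_cons] at h

theorem exists_charPoly [CharZero k] (hfin : ∀ X : NCFinSet, FiniteDimensional k (V.obj X))
    {d : ℕ} (hd : GeneratedInDegree V d) :
    ∃ P : MvPolynomial ℕ+ ℚ, ∀ M : Multiset ℕ+, M ≠ 0 →
      partsTrace V (M.map PNat.val) =
        ((MvPolynomial.eval (fun j => (M.count j : ℚ)) P : ℚ) : k) := by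
  -- The traces are replaced by rational numbers, so that the polynomial has coefficients in `ℚ`;
  -- both relations descend because `ℚ` embeds in `k`.
  choose T hT using fun M : Multiset ℕ+ =>
    exists_rat_eq_partsTrace hfin (M.map PNat.val)
  have hcard : ∀ M A, M ≠ 0 → d < Multiset.card A →
      Multiset.mobius (fun B => T (M + B)) A = 0 := by
    intro M A hM hA
    rw [Multiset.mobius, mul_eq_zero]
    right
    have h := alternating_sum_powerset_partsTrace hfin hd M A hM hA
    simp only [hT] at h
    have h2 : (((A.powerset.map fun B => (-1) ^ Multiset.card B * T (M + B)).sum : ℚ) : k) = 0 := by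
      rw [← h, ← eq_ratCast (algebraMap ℚ k), map_multiset_sum, Multiset.map_map]
      simp
    exact_mod_cast h2
  have hbig : ∀ (j : ℕ+) M, M ≠ 0 → d < j → T (j ::ₘ M) = T M := by
    intro j M hM hj
    have h := partsTrace_cons hfin hd j M hM hj
    rw [hT, hT] at h
    exact_mod_cast h
  obtain ⟨P, hP⟩ := Multiset.exists_mvPolynomial_of_ne_zero d T hcard hbig
  exact ⟨P, fun M hM => by rw [hT, hP M hM]⟩

end

end NCFinSet

theorem mainTheorem9 {k : Type u} [Field k] [CharZero k]
    (V : NCFinSet ⥤ ModuleCat.{w} k) (hV : FunctorFinitelyGenerated V) :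
    (∀ X : NCFinSet, FiniteDimensional k (V.obj X)) ∧
      ∃ P : MvPolynomial ℕ+ ℚ, ∀ n : ℕ, 0 < n → ∀ σ : Equiv.Perm (Fin n),
        (symmRep V n).character σ = ((charPolyValue P σ : ℚ) : k) := by
  have hfin := NCFinSet.finiteDimensional_of_finitelyGenerated hV
  refine ⟨hfin, ?_⟩
  obtain ⟨d, hd⟩ := NCFinSet.exists_generatedInDegree hV
  obtain ⟨P, hP⟩ := NCFinSet.exists_charPoly hfin hd
  refine ⟨P, fun n hn σ => ?_⟩
  have h1 : (symmRep V n).character σ = NCFinSet.partsTrace V σ.partition.parts :=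
    NCFinSet.permTrace_eq_partsTrace σ
  let M : Multiset ℕ+ := σ.partition.parts.pmap (fun j hj => ⟨j, hj⟩)
    fun j hj => σ.partition.parts_pos hj
  have hM : M.map PNat.val = σ.partition.parts := by
    refine (Multiset.map_pmap _ _ _ _).trans ?_
    exact (Multiset.pmap_eq_map _ (fun j => j) _ _).trans (Multiset.map_id' _)
  have hM0 : M ≠ 0 := by
    intro h
    have h2 := σ.partition.parts_sum
    rw [← hM, h, Fintype.card_fin] at h2
    simp at h2
    omega
  rw [h1, ← hM, hP M hM0, charPolyValue]
  congr! 4 with j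
  rw [cycleCount, ← hM, Multiset.count_map_eq_count' _ _ PNat.coe_injective]
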